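/- Identify each face of the square lattice with its centre $(i,j)\in\mathbb{Z}^2$ and call it even if $i+j$ is even. Let $(\mathbb{Z}^2)^\bullet$ be the graph whose vertices are the even faces, with an edge between $(i,j)$ and $(i',j')$ exactly when $|i-i'|=|j-j'|=1$. For an integer $k\ge 0$ let $\Omega_k$ be the subgraph of $(\mathbb{Z}^2)^\bullet$ induced on the even faces with centres in $[-k-1,k+1]^2$, and let its internal boundary be the set of vertices of $\Omega_k$ that have a neighbour in $(\mathbb{Z}^2)^\bullet$ outside $\Omega_k$. Let ${\sf AT}_{\Omega_k,J,U}$ be the Ashkin–Teller measure on $\Omega_k$ with parameters $J,U\in\mathbb{R}$, that is, the probability measure on pairs $(\tau,\tau')\in\{-1,1\}^{V(\Omega_k)}\times\{-1,1\}^{V(\Omega_k)}$ given by $$ {\sf AT}_{\Omega_k,J,U}(\tau,\tau')=\frac1{Z_{\Omega_k,J,U}}\exp\Big[\sum_{\{u,v\}\in E(\Omega_k)}J\big(\tau(u)\tau(v)+\tau'(u)\tau'(v)\big)+U\,\tau(u)\tau(v)\tau'(u)\tau'(v)\Big], $$ where $Z_{\Omega_k,J,U}$ is the normalizing constant, and let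 ${\sf AT}^{\mathrm{free},+}_{\Omega_k,J,U}$ be this measure conditioned on the event that $\tau=\tau'$ on the internal boundary of $\Omega_k$. **Corollary.** Let $J>0$ and $U\in\mathbb{R}$ be such that $\sinh 2J=e^{-2U}$. Then, for every integer $k\ge 0$, the marginal $\mu$ of ${\sf AT}^{\mathrm{free},+}_{\Omega_k,J,U}$ on the pointwise product $\tau\tau'\in\{-1,1\}^{V(\Omega_k)}$ satisfies the FKG lattice condition: for all $\sigma_1,\sigma_2\in\{-1,1\}^{V(\Omega_k)}$, $$ \mu(\sigma_1\vee\sigma_2)\,\mu(\sigma_1\wedge\sigma_2)\ \ge\ \mu(\sigma_1)\,\mu(\sigma_2), $$ where $\vee$ and $\wedge$ are the pointwise maximum and minimum. In particular, $\mu$ is positively associated: for all functions $f,g:\{-1,1\}^{V(\Omega_k)}\to\mathbb{R}$ that are increasing for the pointwise order, $\mu(fg)\ge\mu(f)\,\mu(g)$, where $\mu(\cdot)$ denotes expectation. -/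

import Mathlib

/-- The even faces of the square lattice, each face being identified with its centre `(i, j)`. -/
def EvenFace : Type := {p : ℤ × ℤ // Even (p.1 + p.2)}

/-- The graph on the even faces in which diagonally adjacent faces are linked by an edge. -/
def evenFaceGraph : SimpleGraph EvenFace where
  Adj u v := |u.1.1 - v.1.1| = 1 ∧ |u.1.2 - v.1.2| = 1
  symm := ⟨fun u v h => by
    rw [abs_sub_comm v.1.1, abs_sub_comm v.1.2]
    exact h⟩
  loopless := ⟨fun u h => by simp at h⟩

/-- The even faces whose centres lie in the square `[-k-1, k+1]²`. -/
def evenBox (k : ℕ) : Set EvenFace :=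
  {u | u.1.1 ∈ Set.Icc (-(k : ℤ) - 1) (k + 1) ∧ u.1.2 ∈ Set.Icc (-(k : ℤ) - 1) (k + 1)}

theorem evenBox_finite (k : ℕ) : (evenBox k).Finite := by
  have h : ((Set.Icc (-(k : ℤ) - 1) (k + 1)) ×ˢ (Set.Icc (-(k : ℤ) - 1) (k + 1))).Finite :=
    (Set.finite_Icc _ _).prod (Set.finite_Icc _ _)
  refine (h.preimage (f := (Subtype.val : EvenFace → ℤ × ℤ)) ?_).subset ?_
  · exact Subtype.val_injective.injOn
  · intro u hu
    exact hu

noncomputable instance evenBoxFintype (k : ℕ) : Fintype (evenBox k) :=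
  (evenBox_finite k).fintype

/-- The subgraph of `evenFaceGraph` induced on `evenBox k`. -/
def evenBoxGraph (k : ℕ) : SimpleGraph (evenBox k) :=
  evenFaceGraph.induce (evenBox k)

/-- The internal boundary of `evenBox k`: its vertices with a neighbour outside of it. -/
def internalBoundary (k : ℕ) : Set (evenBox k) :=
  {u | ∃ v : EvenFace, v ∉ evenBox k ∧ evenFaceGraph.Adj u.1 v}

/-- Spin configurations on `V`; `ℤˣ = {-1, 1}` carries the order `-1 < 1`, and configurations
carry the pointwise order and the pointwise product. -/
abbrev SpinConfig (V : Type) : Type := V → ℤˣ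

/-- The real number `1` or `-1` given by a spin. -/
def spinVal (s : ℤˣ) : ℝ := ((s : ℤ) : ℝ)

/-- The contribution of one edge to the exponent of the Ashkin–Teller weight. -/
def atEdgeTerm {V : Type} (J U : ℝ) (x : SpinConfig V × SpinConfig V) : Sym2 V → ℝ :=
  Sym2.lift ⟨fun u v =>
    J * (spinVal (x.1 u) * spinVal (x.1 v) + spinVal (x.2 u) * spinVal (x.2 v))
      + U * (spinVal (x.1 u) * spinVal (x.1 v) * spinVal (x.2 u) * spinVal (x.2 v)),
    fun u v => by ring⟩

open Classical in
/-- The unnormalised Ashkin–Teller weight of a pair of configurations on a finite graph. -/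
noncomputable def atWeight {V : Type} [Fintype V] (G : SimpleGraph V) (J U : ℝ)
    (x : SpinConfig V × SpinConfig V) : ℝ :=
  Real.exp (∑ e ∈ G.edgeFinset, atEdgeTerm J U x e)

open Classical in
theorem atWeight_tsum_ne_zero {V : Type} [Fintype V] (G : SimpleGraph V) (J U : ℝ) :
    ∑' x, ENNReal.ofReal (atWeight G J U x) ≠ 0 := by
  intro h
  have h1 := ENNReal.tsum_eq_zero.mp h (1, 1)
  rw [ENNReal.ofReal_eq_zero] at h1
  exact absurd h1 (not_le.mpr (Real.exp_pos _))

open Classical in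
theorem atWeight_tsum_ne_top {V : Type} [Fintype V] (G : SimpleGraph V) (J U : ℝ) :
    ∑' x, ENNReal.ofReal (atWeight G J U x) ≠ ⊤ := by
  rw [tsum_fintype]
  exact ENNReal.sum_ne_top.mpr fun _ _ => ENNReal.ofReal_ne_top

/-- The Ashkin–Teller measure with parameters `J, U` on a finite graph: the probability
distribution on pairs `(τ, τ')` of spin configurations proportional to `atWeight`. -/
noncomputable def atMeasure {V : Type} [Fintype V] (G : SimpleGraph V) (J U : ℝ) :
    PMF (SpinConfig V × SpinConfig V) :=
  PMF.normalize (fun x => ENNReal.ofReal (atWeight G J U x))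
    (atWeight_tsum_ne_zero G J U) (atWeight_tsum_ne_top G J U)

/-- The event that `τ = τ'` on the set `B` of vertices. -/
def agreeOn {V : Type} (B : Set V) : Set (SpinConfig V × SpinConfig V) :=
  {x | ∀ u ∈ B, x.1 u = x.2 u}

theorem agreeOn_meets_support {V : Type} [Fintype V] (G : SimpleGraph V) (J U : ℝ) (B : Set V) :
    ∃ x ∈ agreeOn B, x ∈ (atMeasure G J U).support := by
  refine ⟨(1, 1), fun _ _ => rfl, ?_⟩
  rw [atMeasure, PMF.mem_support_normalize_iff]
  exact (ENNReal.ofReal_pos.mpr (Real.exp_pos _)).ne'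

/-- The Ashkin–Teller measure on the induced graph on `evenBox k`, conditioned on the event that
`τ = τ'` on the internal boundary. -/
noncomputable def atFreePlus (k : ℕ) (J U : ℝ) :
    PMF (SpinConfig (evenBox k) × SpinConfig (evenBox k)) :=
  (atMeasure (evenBoxGraph k) J U).filter (agreeOn (internalBoundary k))
    (agreeOn_meets_support (evenBoxGraph k) J U (internalBoundary k))

/-- The marginal of `atFreePlus` on the pointwise product `τ τ'`. -/
noncomputable def atProductMarginal (k : ℕ) (J U : ℝ) : PMF (SpinConfig (evenBox k)) :=
  (atFreePlus k J U).map (fun x => x.1 * x.2)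

/-- The FKG lattice condition. -/
def FKGLatticeCondition {V : Type} (μ : PMF (SpinConfig V)) : Prop :=
  ∀ σ₁ σ₂ : SpinConfig V, μ σ₁ * μ σ₂ ≤ μ (σ₁ ⊔ σ₂) * μ (σ₁ ⊓ σ₂)

open Classical in
/-- The expectation of a function of a random spin configuration on a finite set. -/
noncomputable def spinExpectation {V : Type} [Fintype V] (μ : PMF (SpinConfig V))
    (f : SpinConfig V → ℝ) : ℝ :=
  ∑ σ, (μ σ).toReal * f σ

/-- Positive association: increasing functions have non-negative covariance. -/
def PositivelyAssociated {V : Type} [Fintype V] (μ : PMF (SpinConfig V)) : Prop :=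
  ∀ f g : SpinConfig V → ℝ, Monotone f → Monotone g →
    spinExpectation μ f * spinExpectation μ g ≤ spinExpectation μ (fun σ => f σ * g σ)

/-! Fix σ = ττ' and sum over τ. After a factor exp(-U) is extracted from every edge, an edge along
which σ changes sign has weight 1. An edge along which σ is constant has weight exp(2U ± 2J), which
on the self-dual line equals t + 2 or t with t = 2/(exp(4J) - 1). The weight of σ is thus an Ising
partition function on the edges where σ is constant. It splits, up to a constant, into one factor
for the plus vertices and one for the minus vertices.

It remains to see that S ↦ `isingSum t (edgesWithin E S)` is log-supermodular. In the
Fortuin–Kasteleyn expansion, log-supermodularity in the edge set comes from the four functions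
theorem (`isingSum_mul_le`). The edges inside S ∪ T may exceed the union of those inside S and those
inside T, so monotonicity in the edge set is needed too (`isingSum_mono`). This is where the gap 2
between the two weights matters: opening an edge gains a factor 2 and loses at most a factor 2 in
the number of compatible spin configurations.

Conditioning on τ = τ' on the boundary forces σ = 1 there, an event closed under ∨ and ∧. -/

section GraphIsing

open Classical Finset

variable {V : Type}

/-! ### Counting spin configurations constant along given edges -/

/-- The spins of `τ` agree at the two ends of the edge `e`. -/
def EdgeAgree (τ : SpinConfig V) (e : Sym2 V) : Prop := (e.map τ).IsDiag

theorem edgeAgree_mk (τ : SpinConfig V) (u v : V) : EdgeAgree τ s(u, v) ↔ τ u = τ v := by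
  simp [EdgeAgree]

theorem edgeAgree_congr {σ τ : SpinConfig V} {e : Sym2 V} (h : ∀ v ∈ e, σ v = τ v) :
    EdgeAgree σ e ↔ EdgeAgree τ e := by
  induction e using Sym2.ind with
  | _ u v =>
    rw [edgeAgree_mk, edgeAgree_mk, h u (by simp), h v (by simp)]

/-- The configurations that are constant along all edges of `η`. -/
def agreeSubgroup (η : Finset (Sym2 V)) : Subgroup (SpinConfig V) where
  carrier := {τ | ∀ e ∈ η, EdgeAgree τ e}
  mul_mem' := by
    intro a b ha hb e he
    have h1 := ha e he
    have h2 := hb e he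
    induction e using Sym2.ind with
    | _ u v =>
      rw [edgeAgree_mk] at *
      simp [h1, h2]
  one_mem' := by
    intro e _
    induction e using Sym2.ind with
    | _ u v => simp [edgeAgree_mk]
  inv_mem' := by
    intro a ha e he
    have h1 := ha e he
    induction e using Sym2.ind with
    | _ u v =>
      rw [edgeAgree_mk] at *
      simp [h1]

theorem mem_agreeSubgroup {η : Finset (Sym2 V)} {τ : SpinConfig V} :
    τ ∈ agreeSubgroup η ↔ ∀ e ∈ η, EdgeAgree τ e := Iff.rfl

/-- The number of configurations that are constant along all edges of `η`. -/
noncomputable def agreeCount (η : Finset (Sym2 V)) : ℕ := Nat.card (agreeSubgroup η)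

/-- Agreement along one edge is the kernel of τ ↦ τ(u)/τ(v), whose range lies in a group of order 2.
-/
theorem agreeCount_empty_le (e : Sym2 V) :
    agreeCount (∅ : Finset (Sym2 V)) ≤ 2 * agreeCount {e} := by
  induction e using Sym2.ind with
  | _ u v =>
    let f : SpinConfig V →* ℤˣ :=
      Pi.evalMonoidHom (fun _ : V => ℤˣ) u / Pi.evalMonoidHom (fun _ : V => ℤˣ) v
    have h1 : agreeSubgroup {s(u, v)} = f.ker := by
      ext τ
      simp [mem_agreeSubgroup, edgeAgree_mk, f, MonoidHom.mem_ker, div_eq_one]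
    have h2 : agreeSubgroup (∅ : Finset (Sym2 V)) = ⊤ := by
      ext τ
      simp [mem_agreeSubgroup]
    have h3 := f.ker.index_mul_card
    rw [Subgroup.index_ker] at h3
    have h4 : Nat.card f.range ≤ 2 := by
      refine (Subgroup.card_le_card_group f.range).trans ?_
      simp
    unfold agreeCount
    rw [h1, h2, Subgroup.card_top, ← h3]
    exact Nat.mul_le_mul_right _ h4

variable [Fintype V]

theorem agreeCount_pos (η : Finset (Sym2 V)) : 0 < agreeCount η := Nat.card_pos

/-- Second isomorphism theorem: K has the same relative index in H as in H ⊔ K. -/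
theorem Subgroup.card_mul_card_eq_card_inf_mul_card_sup {G : Type*} [CommGroup G]
    (H K : Subgroup G) :
    Nat.card H * Nat.card K = Nat.card (H ⊓ K : Subgroup G) * Nat.card (H ⊔ K : Subgroup G) := by
  have h2 := Subgroup.relIndex_mul_relIndex ⊥ (K ⊓ H) H bot_le inf_le_right
  have h3 := Subgroup.relIndex_mul_relIndex ⊥ K (H ⊔ K) bot_le le_sup_right
  simp only [Subgroup.relIndex_bot_left] at h2 h3
  rw [Subgroup.relIndex_sup_right] at h3
  rw [Subgroup.inf_relIndex_right] at h2
  rw [← h2, ← h3, inf_comm]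
  ring

/-- The two agreement subgroups meet exactly in that of η₁ ∪ η₂, and their join lies inside that of
η₁ ∩ η₂. -/
theorem agreeCount_mul_le (η₁ η₂ : Finset (Sym2 V)) :
    agreeCount η₁ * agreeCount η₂ ≤ agreeCount (η₁ ∩ η₂) * agreeCount (η₁ ∪ η₂) := by
  unfold agreeCount
  rw [Subgroup.card_mul_card_eq_card_inf_mul_card_sup, mul_comm]
  have h1 : agreeSubgroup η₁ ⊓ agreeSubgroup η₂ = agreeSubgroup (η₁ ∪ η₂) := by
    ext τ
    simp only [Subgroup.mem_inf, mem_agreeSubgroup, mem_union, or_imp, forall_and]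
  rw [h1]
  refine Nat.mul_le_mul_right _ (Subgroup.card_le_of_le ?_)
  refine sup_le ?_ ?_ <;> intro τ hτ e he
  · exact hτ e (mem_inter.1 he).1
  · exact hτ e (mem_inter.1 he).2

/-- Supermodularity against the singleton {e} carries the one-edge bound over to any η. -/
theorem agreeCount_le_insert (η : Finset (Sym2 V)) (e : Sym2 V) (he : e ∉ η) :
    agreeCount η ≤ 2 * agreeCount (insert e η) := by
  have h1 := agreeCount_mul_le η {e}
  rw [inter_singleton_of_notMem he, union_comm, ← insert_eq] at h1
  have h2 := agreeCount_empty_le e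
  have h3 := agreeCount_pos ({e} : Finset (Sym2 V))
  refine Nat.le_of_mul_le_mul_right (h1.trans ?_) h3
  calc _ ≤ 2 * agreeCount {e} * agreeCount (insert e η) := Nat.mul_le_mul_right _ h2
    _ = _ := by ring

/-! ### Ising partition functions as functions of the edge set -/

/-- The Ising partition function on the edge set `A` with edge weights `t + 2` for agreement and
`t` for disagreement. -/
noncomputable def isingSum (t : ℝ) (A : Finset (Sym2 V)) : ℝ :=
  ∑ τ : SpinConfig V, ∏ e ∈ A, (t + if EdgeAgree τ e then 2 else 0)

theorem isingSum_pos {t : ℝ} (ht : 0 < t) (A : Finset (Sym2 V)) : 0 < isingSum t A := by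
  refine sum_pos (fun τ _ => prod_pos fun e _ => ?_) univ_nonempty
  split_ifs <;> linarith

/-- The Fortuin–Kasteleyn expansion. -/
theorem isingSum_eq_sum_powerset (t : ℝ) (A : Finset (Sym2 V)) :
    isingSum t A = ∑ η ∈ A.powerset, 2 ^ #η * t ^ #(A \ η) * agreeCount η := by
  unfold isingSum
  simp_rw [add_comm t, prod_add]
  rw [sum_comm]
  refine sum_congr rfl fun η _ => ?_
  simp only [prod_const, prod_ite_zero]
  rw [← sum_mul, ← sum_filter, sum_const, agreeCount, nsmul_eq_mul,
    show Nat.card (agreeSubgroup η) = #{τ : SpinConfig V | ∀ e ∈ η, EdgeAgree τ e} from by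
      rw [Nat.card_eq_fintype_card, Fintype.card_subtype]
      simp only [mem_agreeSubgroup]]
  ring

/-- The terms with e closed are dropped. Those with e open already suffice: the weight 2 of the open
edge makes up for the halving, at worst, of `agreeCount`. -/
theorem isingSum_le_insert {t : ℝ} (ht : 0 < t) (A : Finset (Sym2 V)) (e : Sym2 V) (he : e ∉ A) :
    isingSum t A ≤ isingSum t (insert e A) := by
  rw [isingSum_eq_sum_powerset, isingSum_eq_sum_powerset, sum_powerset_insert he]
  refine le_add_of_nonneg_of_le (sum_nonneg fun _ _ => by positivity) (sum_le_sum fun η hη => ?_)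
  have heη : e ∉ η := fun h => he (mem_powerset.1 hη h)
  rw [insert_sdiff_insert, sdiff_insert_of_notMem he, card_insert_of_notMem heη, pow_succ]
  have h : (agreeCount η : ℝ) ≤ 2 * agreeCount (insert e η) := by
    exact_mod_cast agreeCount_le_insert η e heη
  calc _ ≤ 2 ^ #η * t ^ #(A \ η) * (2 * agreeCount (insert e η)) := by gcongr
    _ = _ := by ring

theorem isingSum_mono {t : ℝ} (ht : 0 < t) : Monotone (isingSum (V := V) t) := by
  intro A B hAB
  obtain ⟨C, hC, rfl⟩ : ∃ C, Disjoint A C ∧ A ∪ C = B :=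
    ⟨B \ A, disjoint_sdiff, union_sdiff_of_subset hAB⟩
  clear hAB hC
  induction C using Finset.induction with
  | empty => simp
  | insert e C _ ih =>
    refine ih.trans ?_
    rw [union_insert]
    by_cases h : e ∈ A ∪ C
    · rw [insert_eq_of_mem h]
    · exact isingSum_le_insert ht _ _ h

/-- With the power of t extracted, the summand no longer depends on A, so a single function serves
all four sums in the four functions theorem. -/
theorem isingSum_eq_pow_mul {t : ℝ} (ht : 0 < t) (A : Finset (Sym2 V)) :
    isingSum t A = t ^ #A * ∑ η ∈ A.powerset, (2 / t) ^ #η * agreeCount η := by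
  rw [isingSum_eq_sum_powerset, mul_sum]
  refine sum_congr rfl fun η hη => ?_
  rw [← card_sdiff_add_card_eq_card (mem_powerset.1 hη), pow_add, div_pow]
  field_simp

theorem isingSum_mul_le {t : ℝ} (ht : 0 < t) (A B : Finset (Sym2 V)) :
    isingSum t A * isingSum t B ≤ isingSum t (A ∩ B) * isingSum t (A ∪ B) := by
  let φ : Finset (Sym2 V) → ℝ := fun η => (2 / t) ^ #η * agreeCount η
  have hφ : 0 ≤ φ := fun η => by positivity
  have key : (∑ η ∈ A.powerset, φ η) * ∑ η ∈ B.powerset, φ η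
      ≤ (∑ η ∈ (A ∩ B).powerset, φ η) * ∑ η ∈ (A ∪ B).powerset, φ η := by
    refine (four_functions_theorem φ φ φ φ hφ hφ hφ hφ ?_ A.powerset B.powerset).trans ?_
    · intro η₁ η₂
      have h : (agreeCount η₁ * agreeCount η₂ : ℝ)
          ≤ agreeCount (η₁ ∩ η₂) * agreeCount (η₁ ∪ η₂) := by
        exact_mod_cast agreeCount_mul_le η₁ η₂
      calc φ η₁ * φ η₂ = (2 / t) ^ (#η₁ + #η₂) * (agreeCount η₁ * agreeCount η₂) := by
            simp only [φ, pow_add]; ring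
        _ ≤ (2 / t) ^ (#η₁ + #η₂) * (agreeCount (η₁ ∩ η₂) * agreeCount (η₁ ∪ η₂)) := by gcongr
        _ = φ (η₁ ⊓ η₂) * φ (η₁ ⊔ η₂) := by
            rw [← card_inter_add_card_union]
            simp only [φ, pow_add, inf_eq_inter, sup_eq_union]; ring
    · refine mul_le_mul (sum_le_sum_of_subset_of_nonneg ?_ fun _ _ _ => hφ _)
        (sum_le_sum_of_subset_of_nonneg ?_ fun _ _ _ => hφ _) (sum_nonneg fun _ _ => hφ _)
        (sum_nonneg fun _ _ => hφ _)
      · intro η h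
        obtain ⟨a, ha, b, hb, rfl⟩ := mem_infs.1 h
        exact mem_powerset.2 (inter_subset_inter (mem_powerset.1 ha) (mem_powerset.1 hb))
      · intro η h
        obtain ⟨a, ha, b, hb, rfl⟩ := mem_sups.1 h
        exact mem_powerset.2 (union_subset_union (mem_powerset.1 ha) (mem_powerset.1 hb))
  simp only [isingSum_eq_pow_mul ht]
  calc _ = t ^ (#A + #B) * ((∑ η ∈ A.powerset, φ η) * ∑ η ∈ B.powerset, φ η) := by
        simp only [φ, pow_add]; ring
    _ ≤ t ^ (#A + #B) * ((∑ η ∈ (A ∩ B).powerset, φ η) * ∑ η ∈ (A ∪ B).powerset, φ η) := by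
        gcongr
    _ = _ := by
        rw [← card_inter_add_card_union]
        simp only [φ, pow_add]; ring

/-! ### Splitting into plus and minus vertices -/

/-- The edges of `E` with both ends in `S`. -/
noncomputable def edgesWithin (E : Finset (Sym2 V)) (S : Finset V) : Finset (Sym2 V) :=
  {e ∈ E | ∀ v ∈ e, v ∈ S}

/-- Edges joining S \ T to T \ S lie within S ∪ T but within neither set; monotonicity in the edge
set absorbs them. -/
theorem isingSum_edgesWithin_mul_le {t : ℝ} (ht : 0 < t) (E : Finset (Sym2 V)) (S T : Finset V) :
    isingSum t (edgesWithin E S) * isingSum t (edgesWithin E T)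
      ≤ isingSum t (edgesWithin E (S ∩ T)) * isingSum t (edgesWithin E (S ∪ T)) := by
  refine (isingSum_mul_le ht _ _).trans ?_
  have h1 : edgesWithin E S ∩ edgesWithin E T = edgesWithin E (S ∩ T) := by
    ext e
    simp only [edgesWithin, mem_inter, mem_filter]
    grind
  have h2 : edgesWithin E S ∪ edgesWithin E T ⊆ edgesWithin E (S ∪ T) := by
    intro e
    simp only [edgesWithin, mem_union, mem_filter]
    grind
  rw [h1]
  exact mul_le_mul_of_nonneg_left (isingSum_mono ht h2) (isingSum_pos ht _).le

/-- Exchange two configurations outside `S`. -/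
noncomputable def exchangeOutside (S : Finset V) :
    SpinConfig V × SpinConfig V ≃ SpinConfig V × SpinConfig V :=
  Function.Involutive.toPerm (fun x => (S.piecewise x.1 x.2, S.piecewise x.2 x.1)) (by
    intro x
    ext v <;> by_cases h : v ∈ S <;> simp [h])

/-- The two edge sets share no vertex, so exchanging a pair of configurations outside S puts both
weights on the first one. The second is then free, whence the cardinality. -/
theorem isingSum_mul_compl (t : ℝ) (E : Finset (Sym2 V)) (S : Finset V) :
    isingSum t (edgesWithin E S) * isingSum t (edgesWithin E Sᶜ)
      = Fintype.card (SpinConfig V) * isingSum t (edgesWithin E S ∪ edgesWithin E Sᶜ) := by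
  have hd : Disjoint (edgesWithin E S) (edgesWithin E Sᶜ) := by
    rw [Finset.disjoint_left]
    intro e h1 h2
    simp only [edgesWithin, mem_filter] at h1 h2
    induction e using Sym2.ind with
    | _ u v =>
      exact (mem_compl.1 (h2.2 u (by simp))) (h1.2 u (by simp))
  let w : Finset (Sym2 V) → SpinConfig V → ℝ :=
    fun A τ => ∏ e ∈ A, (t + if EdgeAgree τ e then 2 else 0)
  have hw : ∀ (A : Finset (Sym2 V)) (σ τ : SpinConfig V),
      (∀ e ∈ A, ∀ v ∈ e, σ v = τ v) → w A σ = w A τ := by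
    intro A σ τ h
    refine prod_congr rfl fun e he => ?_
    simp only [edgeAgree_congr (h e he)]
  calc isingSum t (edgesWithin E S) * isingSum t (edgesWithin E Sᶜ)
      = ∑ x : SpinConfig V × SpinConfig V, w (edgesWithin E S) x.1 * w (edgesWithin E Sᶜ) x.2 := by
        rw [isingSum, isingSum, sum_mul_sum, ← sum_product', univ_product_univ]
    _ = ∑ x : SpinConfig V × SpinConfig V,
          w (edgesWithin E S ∪ edgesWithin E Sᶜ) (exchangeOutside S x).1 := by
        refine sum_congr rfl fun x _ => ?_
        have h1 : (exchangeOutside S x).1 = S.piecewise x.1 x.2 := rfl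
        rw [h1, show w (edgesWithin E S ∪ edgesWithin E Sᶜ) (S.piecewise x.1 x.2) =
          w (edgesWithin E S) (S.piecewise x.1 x.2) * w (edgesWithin E Sᶜ) (S.piecewise x.1 x.2)
          from prod_union hd]
        congr 1 <;> refine hw _ _ _ fun e he v hv => ?_
        · have := (mem_filter.1 he).2 v hv
          simp [this]
        · have := mem_compl.1 ((mem_filter.1 he).2 v hv)
          simp [this]
    _ = ∑ x : SpinConfig V × SpinConfig V, w (edgesWithin E S ∪ edgesWithin E Sᶜ) x.1 :=
        Equiv.sum_comp (exchangeOutside S)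
          (fun x => w (edgesWithin E S ∪ edgesWithin E Sᶜ) x.1)
    _ = _ := by
        rw [← univ_product_univ, sum_product]
        simp only [sum_const, nsmul_eq_mul, card_univ, ← mul_sum]
        rfl

/-- The edges of `E` along which `σ` is constant. -/
noncomputable def agreeEdges (E : Finset (Sym2 V)) (σ : SpinConfig V) : Finset (Sym2 V) :=
  {e ∈ E | EdgeAgree σ e}

/-- The vertices of spin `1`. -/
noncomputable def plusSet (σ : SpinConfig V) : Finset V := {v | σ v = 1}

theorem agreeEdges_eq (E : Finset (Sym2 V)) (σ : SpinConfig V) :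
    agreeEdges E σ = edgesWithin E (plusSet σ) ∪ edgesWithin E (plusSet σ)ᶜ := by
  ext e
  simp only [agreeEdges, edgesWithin, mem_union, mem_filter]
  rw [← and_or_left]
  refine and_congr_right fun _ => ?_
  induction e using Sym2.ind with
  | _ u v =>
    rw [edgeAgree_mk]
    rcases Int.units_eq_one_or (σ u) with hu | hu <;>
      rcases Int.units_eq_one_or (σ v) with hv | hv <;> simp [plusSet, hu, hv]

theorem spin_sup_eq_one (a b : ℤˣ) : a ⊔ b = 1 ↔ a = 1 ∨ b = 1 := by
  rcases Int.units_eq_one_or a with rfl | rfl <;> rcases Int.units_eq_one_or b with rfl | rfl <;>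
    decide

theorem spin_inf_eq_one (a b : ℤˣ) : a ⊓ b = 1 ↔ a = 1 ∧ b = 1 := by
  rcases Int.units_eq_one_or a with rfl | rfl <;> rcases Int.units_eq_one_or b with rfl | rfl <;>
    decide

theorem plusSet_sup (σ₁ σ₂ : SpinConfig V) : plusSet (σ₁ ⊔ σ₂) = plusSet σ₁ ∪ plusSet σ₂ := by
  ext v
  simp [plusSet, spin_sup_eq_one]

theorem plusSet_inf (σ₁ σ₂ : SpinConfig V) : plusSet (σ₁ ⊓ σ₂) = plusSet σ₁ ∩ plusSet σ₂ := by
  ext v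
  simp [plusSet, spin_inf_eq_one]

theorem isingSum_agreeEdges_mul_le {t : ℝ} (ht : 0 < t) (E : Finset (Sym2 V))
    (σ₁ σ₂ : SpinConfig V) :
    isingSum t (agreeEdges E σ₁) * isingSum t (agreeEdges E σ₂)
      ≤ isingSum t (agreeEdges E (σ₁ ⊔ σ₂)) * isingSum t (agreeEdges E (σ₁ ⊓ σ₂)) := by
  have hc : (0 : ℝ) < Fintype.card (SpinConfig V) := by exact_mod_cast Fintype.card_pos
  have hf : ∀ σ : SpinConfig V, isingSum t (agreeEdges E σ) = (Fintype.card (SpinConfig V) : ℝ)⁻¹ *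
      (isingSum t (edgesWithin E (plusSet σ)) * isingSum t (edgesWithin E (plusSet σ)ᶜ)) := by
    intro σ
    rw [isingSum_mul_compl, ← agreeEdges_eq]
    field_simp
  have h1 := isingSum_edgesWithin_mul_le ht E (plusSet σ₁) (plusSet σ₂)
  -- Complementation swaps ∩ and ∪, so the minus vertices obey the same inequality with the roles of
  -- ∨ and ∧ exchanged.
  have h2 := isingSum_edgesWithin_mul_le ht E (plusSet σ₁)ᶜ (plusSet σ₂)ᶜ
  rw [← compl_union, ← compl_inter, ← plusSet_sup, ← plusSet_inf] at h2
  rw [← plusSet_sup, ← plusSet_inf] at h1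
  have h3 := mul_le_mul h1 h2
    (mul_nonneg (isingSum_pos ht _).le (isingSum_pos ht _).le)
    (mul_nonneg (isingSum_pos ht _).le (isingSum_pos ht _).le)
  simp only [hf]
  have h4 := mul_le_mul_of_nonneg_left h3
    (show 0 ≤ (Fintype.card (SpinConfig V) : ℝ)⁻¹ * (Fintype.card (SpinConfig V) : ℝ)⁻¹ by positivity)
  calc _ = _ := ?_
    _ ≤ _ := h4
    _ = _ := ?_
  · ring
  · ring

end GraphIsing

/-! ### The Ashkin–Teller marginal on the self-dual line -/

section AshkinTeller

open Classical Finset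

variable {V : Type}

theorem spinVal_mul (a b : ℤˣ) : spinVal (a * b) = spinVal a * spinVal b := by
  simp [spinVal]

theorem spinVal_mul_spinVal (a b : ℤˣ) : spinVal a * spinVal b = if a = b then 1 else -1 := by
  rcases Int.units_eq_one_or a with rfl | rfl <;> rcases Int.units_eq_one_or b with rfl | rfl <;>
    simp [spinVal]

theorem mem_agreeOn_mul (B : Set V) (σ τ : SpinConfig V) :
    (τ, σ * τ) ∈ agreeOn B ↔ ∀ v ∈ B, σ v = 1 := by
  refine forall₂_congr fun v _ => ?_
  simp

theorem FKGLatticeCondition.of_eq_mul_ofReal {μ : PMF (SpinConfig V)} (C : ENNReal)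
    (w : SpinConfig V → ℝ) (hw : 0 ≤ w) (hμ : ∀ σ, μ σ = C * ENNReal.ofReal (w σ))
    (h : ∀ σ₁ σ₂, w σ₁ * w σ₂ ≤ w (σ₁ ⊔ σ₂) * w (σ₁ ⊓ σ₂)) : FKGLatticeCondition μ := by
  intro σ₁ σ₂
  simp only [hμ]
  rw [mul_mul_mul_comm C (.ofReal (w σ₁)), mul_mul_mul_comm C (.ofReal (w (σ₁ ⊔ σ₂))),
    ← ENNReal.ofReal_mul (hw _), ← ENNReal.ofReal_mul (hw _)]
  exact mul_le_mul' le_rfl (ENNReal.ofReal_le_ofReal (h σ₁ σ₂))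

/-- On the self-dual line, the edge weight given the product `σ` is that of an Ising model on the
edges along which `σ` is constant. -/
theorem exp_atEdgeTerm {J U : ℝ} (hJ : 0 < J) (hself : Real.sinh (2 * J) = Real.exp (-2 * U))
    (σ τ : SpinConfig V) (e : Sym2 V) :
    Real.exp (atEdgeTerm J U (τ, σ * τ) e) = Real.exp (-U) *
      if EdgeAgree σ e then
        (2 / (Real.exp (4 * J) - 1) + if EdgeAgree τ e then 2 else 0) else 1 := by
  have hp : 0 < Real.exp (4 * J) - 1 := by
    have := Real.add_one_lt_exp (show 4 * J ≠ 0 by positivity)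
    linarith
  have h4 : Real.exp (4 * J) = Real.exp (2 * J) * Real.exp (2 * J) := by
    rw [← Real.exp_add]; ring_nf
  -- Case where σ agrees and τ disagrees along the edge; the self-dual relation enters only here.
  have hdis : Real.exp (U - 2 * J) = Real.exp (-U) * (2 / (Real.exp (4 * J) - 1)) := by
    have h5 : Real.exp (U - 2 * J) = Real.exp (-U) * (Real.exp (2 * J) * Real.exp (-2 * U))⁻¹ := by
      rw [← Real.exp_add, ← Real.exp_neg, ← Real.exp_add]; ring_nf
    rw [h5, ← hself, Real.sinh_eq, Real.exp_neg (2 * J), h4]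
    have h6 : Real.exp (2 * J) * ((Real.exp (2 * J) - (Real.exp (2 * J))⁻¹) / 2) =
        (Real.exp (2 * J) * Real.exp (2 * J) - 1) / 2 := by
      field_simp
    rw [h6, inv_div]
  -- With t = 2/(exp(4J) - 1), one has t · exp(4J) = t + 2.
  have hagr : Real.exp (U + 2 * J) = Real.exp (-U) * (2 / (Real.exp (4 * J) - 1) + 2) := by
    have h5 : Real.exp (U + 2 * J) = Real.exp (U - 2 * J) * Real.exp (4 * J) := by
      rw [← Real.exp_add]; ring_nf
    rw [h5, hdis]
    field_simp
    ring
  induction e using Sym2.ind with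
  | _ u v =>
    simp only [edgeAgree_mk]
    have hterm : atEdgeTerm J U (τ, σ * τ) s(u, v) =
        J * (spinVal (τ u) * spinVal (τ v)
          + (spinVal (σ u) * spinVal (σ v)) * (spinVal (τ u) * spinVal (τ v)))
        + U * ((spinVal (σ u) * spinVal (σ v)) *
          ((spinVal (τ u) * spinVal (τ v)) * (spinVal (τ u) * spinVal (τ v)))) := by
      simp only [atEdgeTerm, Sym2.lift_mk, Pi.mul_apply, spinVal_mul]
      ring
    rw [hterm, spinVal_mul_spinVal, spinVal_mul_spinVal]
    by_cases hσ : σ u = σ v <;> by_cases hτ : τ u = τ v <;> simp only [hσ, hτ, if_true, if_false]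
    · rw [← hagr]; ring_nf
    · rw [add_zero, ← hdis]; ring_nf
    · ring_nf
    · ring_nf

variable [Fintype V]

/-- Edges along which σ is not constant contribute only exp(-U), whatever τ is, and so leave the
Ising sum. -/
theorem sum_atWeight {J U : ℝ} (hJ : 0 < J) (hself : Real.sinh (2 * J) = Real.exp (-2 * U))
    (G : SimpleGraph V) (σ : SpinConfig V) :
    ∑ τ, atWeight G J U (τ, σ * τ) = Real.exp (-U) ^ #G.edgeFinset *
      isingSum (2 / (Real.exp (4 * J) - 1)) (agreeEdges G.edgeFinset σ) := by
  simp only [atWeight, Real.exp_sum, exp_atEdgeTerm hJ hself, prod_mul_distrib, prod_const]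
  rw [← mul_sum]
  simp only [isingSum, agreeEdges, prod_filter]

theorem sum_ite_eq_mul {M : Type*} [AddCommMonoid M] (σ : SpinConfig V)
    (F : SpinConfig V × SpinConfig V → M) :
    ∑ x, (if σ = x.1 * x.2 then F x else 0) = ∑ τ, F (τ, σ * τ) := by
  rw [Fintype.sum_prod_type]
  refine sum_congr rfl fun τ _ => ?_
  have h : ∀ y, σ = τ * y ↔ σ * τ = y := by
    intro y
    have hτ : τ * τ = 1 := by
      ext v
      simp
    constructor
    · rintro rfl
      rw [mul_right_comm, hτ, one_mul]
    · rintro rfl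
      rw [mul_left_comm, hτ, mul_one]
  simp only [h, sum_ite_eq, mem_univ, if_true]

theorem productMarginal_apply {J U : ℝ} (hJ : 0 < J)
    (hself : Real.sinh (2 * J) = Real.exp (-2 * U)) (G : SimpleGraph V) (B : Set V) :
    ∃ C : ENNReal, ∀ σ,
      (((atMeasure G J U).filter (agreeOn B) (agreeOn_meets_support G J U B)).map
        (fun x => x.1 * x.2)) σ =
      C * ENNReal.ofReal (if ∀ v ∈ B, σ v = 1 then
        isingSum (2 / (Real.exp (4 * J) - 1)) (agreeEdges G.edgeFinset σ) else 0) := by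
  -- The constant collects the edge factors exp(-U), the Ashkin–Teller normalization and that of the
  -- conditioning.
  refine ⟨ENNReal.ofReal (Real.exp (-U) ^ #G.edgeFinset) *
    (∑' x, ENNReal.ofReal (atWeight G J U x))⁻¹ *
    (∑' x, (agreeOn B).indicator (atMeasure G J U) x)⁻¹, fun σ => ?_⟩
  have hexp : 0 ≤ Real.exp (-U) ^ #G.edgeFinset := by positivity
  rw [PMF.map_apply, tsum_fintype]
  have h0 := sum_ite_eq_mul σ
    ((atMeasure G J U).filter (agreeOn B) (agreeOn_meets_support G J U B))
  refine Eq.trans (b := ∑ τ, ((atMeasure G J U).filter (agreeOn B)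
    (agreeOn_meets_support G J U B)) (τ, σ * τ)) (by convert h0) ?_
  simp only [PMF.filter_apply, Set.indicator_apply, mem_agreeOn_mul]
  split_ifs with hB
  · rw [← sum_mul]
    simp only [atMeasure, PMF.normalize_apply]
    rw [← sum_mul, ← ENNReal.ofReal_sum_of_nonneg fun τ _ => (show 0 ≤ atWeight G J U (τ, σ * τ) from
        (Real.exp_pos _).le),
      sum_atWeight hJ hself, ENNReal.ofReal_mul hexp]
    ring
  · simp

theorem fkgLatticeCondition_productMarginal {J U : ℝ} (hJ : 0 < J)
    (hself : Real.sinh (2 * J) = Real.exp (-2 * U)) (G : SimpleGraph V) (B : Set V) :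
    FKGLatticeCondition (((atMeasure G J U).filter (agreeOn B)
      (agreeOn_meets_support G J U B)).map (fun x => x.1 * x.2)) := by
  obtain ⟨C, hC⟩ := productMarginal_apply hJ hself G B
  have ht : 0 < 2 / (Real.exp (4 * J) - 1) := by
    have := Real.add_one_lt_exp (show 4 * J ≠ 0 by positivity)
    exact div_pos two_pos (by linarith)
  have hpos : 0 ≤ fun σ : SpinConfig V => if ∀ v ∈ B, σ v = 1 then
      isingSum (2 / (Real.exp (4 * J) - 1)) (agreeEdges G.edgeFinset σ) else 0 := by
    intro σ
    dsimp only [Pi.zero_apply]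
    split_ifs
    · exact (isingSum_pos ht _).le
    · exact le_rfl
  refine FKGLatticeCondition.of_eq_mul_ofReal C _ hpos hC fun σ₁ σ₂ => ?_
  by_cases h : (∀ v ∈ B, σ₁ v = 1) ∧ ∀ v ∈ B, σ₂ v = 1
  · have hsup : ∀ v ∈ B, (σ₁ ⊔ σ₂) v = 1 := fun v hv => (spin_sup_eq_one _ _).2 (.inl (h.1 v hv))
    have hinf : ∀ v ∈ B, (σ₁ ⊓ σ₂) v = 1 :=
      fun v hv => (spin_inf_eq_one _ _).2 ⟨h.1 v hv, h.2 v hv⟩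
    rw [if_pos h.1, if_pos h.2, if_pos hsup, if_pos hinf]
    exact isingSum_agreeEdges_mul_le ht _ _ _
  -- If either configuration violates the boundary condition, the left-hand side vanishes.
  · refine le_of_eq_of_le ?_ (mul_nonneg (hpos _) (hpos _))
    rcases not_and_or.1 h with h | h <;> simp only [if_neg h, zero_mul, mul_zero]

/-- The Fortuin–Kasteleyn–Ginibre inequality. -/
theorem FKGLatticeCondition.positivelyAssociated {μ : PMF (SpinConfig V)}
    (hμ : FKGLatticeCondition μ) : PositivelyAssociated μ := by
  intro f g hf hg
  have hsum : ∑ σ, (μ σ).toReal = 1 := by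
    have h := μ.tsum_coe
    rw [tsum_fintype] at h
    rw [← ENNReal.toReal_sum fun σ _ => μ.apply_ne_top σ, h, ENNReal.toReal_one]
  have hbot : ∀ σ : SpinConfig V, (fun _ => -1) ≤ σ := by
    intro σ v
    show (-1 : ℤˣ) ≤ σ v
    rcases Int.units_eq_one_or (σ v) with h | h
    · rw [h]; decide
    · rw [h]
  -- `fkg` requires nonnegative functions, so the minima, attained at the all-minus configuration,
  -- are subtracted; covariances are unaffected.
  set a := f fun _ => -1
  set b := g fun _ => -1
  have key := fkg (fun σ => f σ - a) (fun σ => g σ - b) (fun σ => (μ σ).toReal)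
    (fun σ => ENNReal.toReal_nonneg) (fun σ => sub_nonneg.2 (hf (hbot σ)))
    (fun σ => sub_nonneg.2 (hg (hbot σ))) (fun _ _ h => sub_le_sub_right (hf h) _)
    (fun _ _ h => sub_le_sub_right (hg h) _) (fun σ₁ σ₂ => by
      rw [← ENNReal.toReal_mul, ← ENNReal.toReal_mul, mul_comm (μ (σ₁ ⊓ σ₂))]
      exact ENNReal.toReal_mono (ENNReal.mul_ne_top (μ.apply_ne_top _) (μ.apply_ne_top _))
        (hμ σ₁ σ₂))
  have e1 : ∀ (h : SpinConfig V → ℝ) (c : ℝ), ∑ σ, (μ σ).toReal * (h σ - c)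
      = ∑ σ, (μ σ).toReal * h σ - c := by
    intro h c
    simp only [mul_sub, sum_sub_distrib]
    rw [← sum_mul, hsum, one_mul]
  have e2 : ∑ σ, (μ σ).toReal * ((f σ - a) * (g σ - b)) = ∑ σ, (μ σ).toReal * (f σ * g σ)
      - b * ∑ σ, (μ σ).toReal * f σ - a * ∑ σ, (μ σ).toReal * g σ + a * b := by
    rw [mul_sum, mul_sum, ← sum_sub_distrib, ← sum_sub_distrib]
    conv_rhs => rw [← mul_one (a * b), ← hsum, mul_sum, ← sum_add_distrib]
    refine sum_congr rfl fun σ _ => ?_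
    ring
  rw [e1, e1, hsum, one_mul, e2] at key
  unfold spinExpectation
  linarith

end AshkinTeller

theorem corollary2p7 (J U : ℝ) (hJ : 0 < J) (hself : Real.sinh (2 * J) = Real.exp (-2 * U))
    (k : ℕ) :
    FKGLatticeCondition (atProductMarginal k J U) ∧
      PositivelyAssociated (atProductMarginal k J U) := by
  have h : FKGLatticeCondition (atProductMarginal k J U) :=
    fkgLatticeCondition_productMarginal hJ hself _ _
  exact ⟨h, h.positivelyAssociated⟩
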